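/- Let $n$ qumodes be given, with state space $L^2(\mathbb{R}^n)$ (position representation), quadrature operators $\hat q_j$ (multiplication by $q_j$) and $\hat p_j=-i\,\partial/\partial q_j$, and $\hat a_j=\tfrac1{\sqrt2}(\hat q_j+i\hat p_j)$, $\hat a_j^\dagger=\tfrac1{\sqrt2}(\hat q_j-i\hat p_j)$, all taken on the Schwartz space $\mathcal S(\mathbb{R}^n)$. The Schwinger $U(2)$ operators of the qumodes $r,s$ are $\hat S^0_{r,s}=\tfrac12(\hat a_r^\dagger\hat a_r+\hat a_s^\dagger\hat a_s)$, $\hat S^x_{r,s}=\tfrac12(\hat a_r^\dagger\hat a_s+\hat a_s^\dagger\hat a_r)$, $\hat S^y_{r,s}=\tfrac1{2i}(\hat a_r^\dagger\hat a_s-\hat a_s^\dagger\hat a_r)$, $\hat S^z_{r,s}=\tfrac12(\hat a_r^\dagger\hat a_r-\hat a_s^\dagger\hat a_s)$. Let $|\phi_{\mathbf K}\rangle$ be a Gaussian pure state with adjacency matrix $\mathbf K$, i.e. the state with wavefunction $$\psi_{\mathbf Z}(\mathbf q)=\frac{\det(\mathbf U)^{1/4}}{\pi^{n/4}}\exp\!\left(\tfrac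 i2\,\mathbf q^T\mathbf Z\mathbf q\right),\qquad \mathbf Z=\mathbf V+i\mathbf U,\quad \mathbf K=(\mathbf I+i\mathbf Z)(\mathbf I-i\mathbf Z)^{-1},$$ where $\mathbf V,\mathbf U$ are real symmetric $n\times n$ matrices and $\mathbf U$ is positive definite. Let $\hat N$ be a Schwinger nullifier for this state, i.e. a real linear combination of Schwinger $U(2)$ operators with $\hat N|\phi_{\mathbf K}\rangle=0$. Then there is exactly one strongly continuous one-parameter group of unitary operators $\hat U(\theta)=e^{-i\theta\hat N}$, $\theta\in\mathbb{R}$, on $L^2(\mathbb{R}^n)$ whose generator (in the sense of Stone) is the closure of $\hat N$. For every $\theta\in\mathbb{R}$, $\hat U(\theta)$ is a passive interferometric operation, that is, it is of the form $e^{-i\hat H}$ with $\hat H=\sum_{i,j}\Pi_{ij}\hat a_i^\dagger\hat a_j$ for some Hermitian matrix $\Pi$; it conserves the total photon number, that is, it maps the domain of the closure of $\sum_i\hat a_i^\dagger\hat a_i$ into itself and commutes with this operator there; and it leaves the state invariant: $\hat U(\theta)|\phi_{\mathbf K}\rangle=|\phi_{\mathbf K}\rangle$. -/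

import Mathlib

open MeasureTheory Matrix Complex
open scoped SchwartzMap LineDeriv

noncomputable section

namespace Qumode

/-- Configuration space of `n` qumodes: the vectors of positions. -/
abbrev Pos (n : ℕ) : Type := EuclideanSpace ℝ (Fin n)

/-- The state space of `n` qumodes, in the position representation. -/
abbrev Hilb (n : ℕ) : Type := Lp ℂ 2 (volume : Measure (Pos n))

/-- Operators with domain the Schwartz space, a common invariant dense domain of all polynomials
in the quadrature operators. -/
abbrev Op (n : ℕ) : Type := Module.End ℂ 𝓢(Pos n, ℂ)

/-- The vector of the state space given by a Schwartz wavefunction. -/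
def toState {n : ℕ} (ψ : 𝓢(Pos n, ℂ)) : Hilb n := ψ.toLp 2 volume

/-- The position operator of qumode `j`. -/
def position {n : ℕ} (j : Fin n) : Op n :=
  (SchwartzMap.smulLeftCLM ℂ (fun x : Pos n => ((x j : ℝ) : ℂ))).toLinearMap

theorem position_apply {n : ℕ} (j : Fin n) (ψ : 𝓢(Pos n, ℂ)) (x : Pos n) :
    position j ψ x = (x j : ℂ) * ψ x := by
  have h : (fun x : Pos n => ((x j : ℝ) : ℂ)).HasTemperateGrowth :=
    (Complex.ofRealCLM.comp (EuclideanSpace.proj j : Pos n →L[ℝ] ℝ)).hasTemperateGrowth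
  simp [position, SchwartzMap.smulLeftCLM_apply_apply h]

/-- The momentum operator of qumode `j`, with `ħ = 1`. -/
def momentum {n : ℕ} (j : Fin n) : Op n :=
  (-I) • (LineDeriv.lineDerivOpCLM ℂ 𝓢(Pos n, ℂ)
    (EuclideanSpace.single j (1 : ℝ))).toLinearMap

theorem momentum_apply {n : ℕ} (j : Fin n) (ψ : 𝓢(Pos n, ℂ)) (x : Pos n) :
    momentum j ψ x = -I * fderiv ℝ ψ x (EuclideanSpace.single j (1 : ℝ)) := by
  simp [momentum, SchwartzMap.lineDerivOp_apply_eq_fderiv]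

/-- The annihilation operator of qumode `j`. -/
def annih {n : ℕ} (j : Fin n) : Op n :=
  ((1 / Real.sqrt 2 : ℝ) : ℂ) • (position j + I • momentum j)

/-- The creation operator of qumode `j`. -/
def creat {n : ℕ} (j : Fin n) : Op n :=
  ((1 / Real.sqrt 2 : ℝ) : ℂ) • (position j - I • momentum j)

/-- The labels of the four generators of `U(2)`. -/
inductive Axis
  | zero
  | x
  | y
  | z

/-- The Schwinger `U(2)` operators of the qumodes `r` and `s`. -/
def schwinger {n : ℕ} (r s : Fin n) : Axis → Op n
  | Axis.zero => (1 / 2 : ℂ) • (creat r * annih r + creat s * annih s)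
  | Axis.x => (1 / 2 : ℂ) • (creat r * annih s + creat s * annih r)
  | Axis.y => (1 / (2 * I) : ℂ) • (creat r * annih s - creat s * annih r)
  | Axis.z => (1 / 2 : ℂ) • (creat r * annih r - creat s * annih s)

/-- The real linear combinations of Schwinger `U(2)` operators. (With `r = s` allowed the single
mode number operator is one of them also if `n = 1`; if `n ≥ 2` the combinations are the same as
those for `r ≠ s`.) -/
def IsSchwingerCombination {n : ℕ} (N : Op n) : Prop :=
  ∃ c : Fin n → Fin n → Axis → ℝ,
    N = ∑ r, ∑ s, (((c r s Axis.zero : ℝ) : ℂ) • schwinger r s Axis.zero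
      + ((c r s Axis.x : ℝ) : ℂ) • schwinger r s Axis.x
      + ((c r s Axis.y : ℝ) : ℂ) • schwinger r s Axis.y
      + ((c r s Axis.z : ℝ) : ℂ) • schwinger r s Axis.z)

/-- `φ` is in the domain of `N` and `N φ = 0`. -/
def IsNullifier {n : ℕ} (N : Op n) (φ : Hilb n) : Prop :=
  ∃ ψ : 𝓢(Pos n, ℂ), toState ψ = φ ∧ N ψ = 0

/-- A Schwinger nullifier of the state `φ`. -/
def IsSchwingerNullifier {n : ℕ} (N : Op n) (φ : Hilb n) : Prop :=
  IsSchwingerCombination N ∧ IsNullifier N φ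

/-- The matrix `Z = V + iU`. -/
def graphMatrix {n : ℕ} (V U : Matrix (Fin n) (Fin n) ℝ) : Matrix (Fin n) (Fin n) ℂ :=
  V.map (fun a : ℝ => (a : ℂ)) + I • U.map (fun a : ℝ => (a : ℂ))

/-- The wavefunction `det(U)^{1/4} π^{-n/4} exp((i/2) qᵀ Z q)`, where `Z = V + iU`. -/
def gaussianWave {n : ℕ} (V U : Matrix (Fin n) (Fin n) ℝ) (q : Pos n) : ℂ :=
  ((U.det ^ (1 / 4 : ℝ) / Real.pi ^ ((n : ℝ) / 4) : ℝ) : ℂ) *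
    Complex.exp (I / 2 * ∑ i, ∑ j, (q i : ℂ) * graphMatrix V U i j * (q j : ℂ))

/-- `φ` is the Gaussian pure state with adjacency matrix `K`. -/
def IsGaussianPureState {n : ℕ} (K : Matrix (Fin n) (Fin n) ℂ) (φ : Hilb n) : Prop :=
  ∃ V U : Matrix (Fin n) (Fin n) ℝ, V.IsSymm ∧ U.PosDef ∧
    K = (1 + I • graphMatrix V U) * (1 - I • graphMatrix V U)⁻¹ ∧
    (φ : Pos n → ℂ) =ᵐ[volume] gaussianWave V U

/-- The graph of the closure of the operator `A`. -/
def closedGraph {n : ℕ} (A : Op n) : Set (Hilb n × Hilb n) :=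
  closure (Set.range fun ψ : 𝓢(Pos n, ℂ) => (toState ψ, toState (A ψ)))

/-- `U` is the one-parameter unitary group `θ ↦ exp(-iθA)`: a strongly continuous unitary
representation of the real line whose infinitesimal generator, in the sense of Stone, is exactly
the closure of `A`. -/
structure IsExpGroup {n : ℕ} (A : Op n) (U : ℝ → Hilb n →L[ℂ] Hilb n) : Prop where
  mem_unitary : ∀ θ, U θ ∈ unitary (Hilb n →L[ℂ] Hilb n)
  map_zero : U 0 = 1
  map_add : ∀ θ θ', U (θ + θ') = U θ * U θ'
  strongly_continuous : ∀ f, Continuous fun θ => U θ f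
  generator : {p : Hilb n × Hilb n | HasDerivAt (fun θ : ℝ => U θ p.1) (-(I • p.2)) 0}
    = closedGraph A

/-- The Hamiltonian `∑ Πᵢⱼ aᵢ† aⱼ`. -/
def quadHamiltonian {n : ℕ} (P : Matrix (Fin n) (Fin n) ℂ) : Op n :=
  ∑ i, ∑ j, P i j • (creat i * annih j)

/-- Passive interferometric operations: the unitaries `exp(-iH)`, where `H = ∑ Πᵢⱼ aᵢ† aⱼ` with `Π`
Hermitian is a compact quadratic Hamiltonian. -/
def IsPassiveInterferometric {n : ℕ} (W : Hilb n →L[ℂ] Hilb n) : Prop :=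
  ∃ P : Matrix (Fin n) (Fin n) ℂ, P.IsHermitian ∧
    ∃ U : ℝ → Hilb n →L[ℂ] Hilb n, IsExpGroup (quadHamiltonian P) U ∧ W = U 1

/-- The total photon number operator. -/
def totalNumber (n : ℕ) : Op n := ∑ i, creat i * annih i

/-- `W` conserves the total photon number: it maps the domain of the (closed) total photon number
operator into itself and commutes with that operator there. -/
def ConservesPhotonNumber {n : ℕ} (W : Hilb n →L[ℂ] Hilb n) : Prop :=
  ∀ f g : Hilb n, (f, g) ∈ closedGraph (totalNumber n) →
    (W f, W g) ∈ closedGraph (totalNumber n)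

end Qumode

end

/-!
A Schwinger nullifier is `N = ∑ Πᵢⱼ aᵢ† aⱼ` with `Π` Hermitian, so it preserves each level of total
photon number `m`: the finite-dimensional space of Schwartz functions obtained from the vacuum by
creating `m` photons. There it is a symmetric operator and can be diagonalized. The levels span a
dense subspace, because they contain all polynomials times the vacuum, and an integrable function
with exponential decay whose moments all vanish has vanishing Fourier transform. Hence there is a
Hilbert basis of Schwartz functions that are joint eigenfunctions of `N` and of the total photon
number. The closures of both operators are multiplication operators in the coordinates of this
basis, and `exp(-iθN)` multiplies the coordinates by phases. Uniqueness and invariance of the state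
both hold because a group with generator `A` acts on an eigenvector of `A` with eigenvalue `c` by
`exp(-iθc)`.
-/

noncomputable section

open Filter Topology

section HilbertBasisCoordinates

variable {ι 𝕜 H : Type*} [RCLike 𝕜] [NormedAddCommGroup H] [InnerProductSpace 𝕜 H]

theorem hasSum_norm_repr_sq (b : HilbertBasis ι 𝕜 H) (x : H) :
    HasSum (fun k => ‖b.repr x k‖ ^ 2) (‖x‖ ^ 2) := by
  simpa using lp.hasSum_norm (p := 2) (by norm_num) (b.repr x)

theorem eq_of_forall_repr_eq (b : HilbertBasis ι 𝕜 H) {x y : H}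
    (h : ∀ k, b.repr x k = b.repr y k) : x = y :=
  b.repr.injective (lp.ext (funext h))

theorem tendsto_of_forall_tendsto_repr (b : HilbertBasis ι 𝕜 H) {α : Type*} {l : Filter α}
    {F : α → H} {y z : H} (hz : ∀ᶠ a in l, ∀ k, ‖b.repr (F a) k‖ ≤ ‖b.repr z k‖)
    (hF : ∀ k, Tendsto (fun a => b.repr (F a) k) l (𝓝 (b.repr y k))) :
    Tendsto F l (𝓝 y) := by
  obtain rfl | hl := l.eq_or_neBot
  · exact tendsto_bot
  have hy : ∀ k, ‖b.repr y k‖ ≤ ‖b.repr z k‖ := fun k =>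
    le_of_tendsto (hF k).norm (hz.mono fun a ha => ha k)
  have h_sub : ∀ k, Tendsto (fun a => b.repr (F a - y) k) l (𝓝 0) := fun k => by
    simpa using (hF k).sub_const (b.repr y k)
  have h_bound : ∀ᶠ a in l, ∀ k, ‖b.repr (F a - y) k‖ ≤ 2 * ‖b.repr z k‖ := by
    filter_upwards [hz] with a ha k
    rw [map_sub, lp.coeFn_sub, Pi.sub_apply]
    linarith [norm_sub_le (b.repr (F a) k) (b.repr y k), ha k, hy k]
  have h_sum : Tendsto (fun a => ∑' k, ‖b.repr (F a - y) k‖ ^ 2) l (𝓝 (∑' _ : ι, (0 : ℝ))) := by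
    refine tendsto_tsum_of_dominated_convergence (bound := fun k => (2 * ‖b.repr z k‖) ^ 2)
      ?_ (fun k => by simpa using (h_sub k).norm.pow 2) ?_
    · simpa only [mul_pow] using (hasSum_norm_repr_sq b z).summable.mul_left (2 ^ 2)
    · filter_upwards [h_bound] with a ha k
      simpa using pow_le_pow_left₀ (norm_nonneg _) (ha k) 2
  have h_sq : Tendsto (fun a => ‖F a - y‖ ^ 2) l (𝓝 0) := by
    simpa only [(hasSum_norm_repr_sq b _).tsum_eq, tsum_zero] using h_sum
  rw [tendsto_iff_norm_sub_tendsto_zero]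
  simpa [Real.sqrt_sq] using h_sq.sqrt

end HilbertBasisCoordinates

section DiagonalGroup

variable {ι H : Type*} [NormedAddCommGroup H] [InnerProductSpace ℂ H]

/-- The isometry of `ℓᵖ` that multiplies the `k`-th coordinate by the phase `c k`. -/
def lpPhase (p : ENNReal) [Fact (1 ≤ p)] (c : ι → Circle) :
    lp (fun _ : ι => ℂ) p ≃ₗᵢ[ℂ] lp (fun _ : ι => ℂ) p where
  toFun f := ⟨fun k => c k * f k, (lp.memℓp f).mono' fun k => by simp [Circle.norm_coe]⟩
  invFun f := ⟨fun k => (c k)⁻¹ * f k, (lp.memℓp f).mono' fun k => by simp [Circle.norm_coe]⟩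
  map_add' f g := lp.ext <| funext fun k => mul_add _ _ _
  map_smul' a f := lp.ext <| funext fun k => mul_left_comm _ _ _
  left_inv f := lp.ext <| funext fun k => by simp
  right_inv f := lp.ext <| funext fun k => by simp
  norm_map' f := by
    have hp : p ≠ 0 := (zero_lt_one.trans_le Fact.out).ne'
    exact le_antisymm (lp.norm_mono hp fun k => by simp [Circle.norm_coe])
      (lp.norm_mono hp fun k => by simp [Circle.norm_coe])

/-- The unitary operator that multiplies the `k`-th coordinate in the Hilbert basis `b` by the
phase `c k`. -/
def diagonalUnitary (b : HilbertBasis ι ℂ H) (c : ι → Circle) : H ≃ₗᵢ[ℂ] H :=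
  b.repr.trans ((lpPhase 2 c).trans b.repr.symm)

theorem repr_diagonalUnitary (b : HilbertBasis ι ℂ H) (c : ι → Circle) (x : H) (k : ι) :
    b.repr (diagonalUnitary b c x) k = c k * b.repr x k := by
  simp [diagonalUnitary, lpPhase]

/-- The one-parameter group `θ ↦ exp(-iθA)`, where `A` is the operator that multiplies the `k`-th
coordinate in the Hilbert basis `b` by `lam k`. -/
def diagonalGroup (b : HilbertBasis ι ℂ H) (lam : ι → ℝ) (θ : ℝ) : H →L[ℂ] H :=
  ((diagonalUnitary b fun k => Circle.exp (-(θ * lam k))).toContinuousLinearEquiv : H →L[ℂ] H)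

theorem repr_diagonalGroup (b : HilbertBasis ι ℂ H) (lam : ι → ℝ) (θ : ℝ) (x : H) (k : ι) :
    b.repr (diagonalGroup b lam θ x) k = cexp (I * (-(θ * lam k) : ℝ)) * b.repr x k := by
  rw [mul_comm I, ← Circle.coe_exp]
  exact repr_diagonalUnitary b _ x k

theorem norm_repr_diagonalGroup (b : HilbertBasis ι ℂ H) (lam : ι → ℝ) (θ : ℝ) (x : H) (k : ι) :
    ‖b.repr (diagonalGroup b lam θ x) k‖ = ‖b.repr x k‖ := by
  rw [repr_diagonalGroup, norm_mul, norm_exp_I_mul_ofReal, one_mul]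

theorem diagonalGroup_zero (b : HilbertBasis ι ℂ H) (lam : ι → ℝ) : diagonalGroup b lam 0 = 1 :=
  ContinuousLinearMap.ext fun x => eq_of_forall_repr_eq b fun k => by simp [repr_diagonalGroup]

theorem diagonalGroup_add (b : HilbertBasis ι ℂ H) (lam : ι → ℝ) (θ θ' : ℝ) :
    diagonalGroup b lam (θ + θ') = diagonalGroup b lam θ * diagonalGroup b lam θ' := by
  refine ContinuousLinearMap.ext fun x => eq_of_forall_repr_eq b fun k => ?_
  rw [mul_apply_eq_comp]
  simp only [repr_diagonalGroup]
  rw [← mul_assoc, ← Complex.exp_add]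
  congr 2
  push_cast
  ring

theorem diagonalGroup_mul_left (b : HilbertBasis ι ℂ H) (lam : ι → ℝ) (θ t : ℝ) :
    diagonalGroup b (fun k => θ * lam k) t = diagonalGroup b lam (t * θ) :=
  ContinuousLinearMap.ext fun x => eq_of_forall_repr_eq b fun k => by
    simp only [repr_diagonalGroup, mul_assoc]

theorem continuous_diagonalGroup_apply (b : HilbertBasis ι ℂ H) (lam : ι → ℝ) (x : H) :
    Continuous fun θ => diagonalGroup b lam θ x := by
  refine continuous_iff_continuousAt.mpr fun θ =>
    tendsto_of_forall_tendsto_repr b (z := x) (Eventually.of_forall fun t k => ?_) fun k => ?_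
  · exact (norm_repr_diagonalGroup b lam t x k).le
  · simp only [repr_diagonalGroup]
    exact Continuous.tendsto (by fun_prop) θ

theorem hasDerivAt_repr_diagonalGroup_zero (b : HilbertBasis ι ℂ H) (lam : ι → ℝ) (x : H)
    (k : ι) :
    HasDerivAt (fun θ => b.repr (diagonalGroup b lam θ x) k) (-(I * (lam k * b.repr x k))) 0 := by
  have h_exponent : HasDerivAt (fun θ : ℝ => I * (-(θ * lam k) : ℝ)) (-(I * lam k)) 0 := by
    simpa using ((hasDerivAt_mul_const (lam k) (x := (0 : ℝ))).fun_neg.ofReal_comp).const_mul I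
  simp only [repr_diagonalGroup]
  simpa [mul_assoc] using h_exponent.cexp.mul_const (b.repr x k)

theorem norm_repr_slope_diagonalGroup_le (b : HilbertBasis ι ℂ H) (lam : ι → ℝ) (x : H) (t : ℝ)
    (k : ι) :
    ‖b.repr (t⁻¹ • (diagonalGroup b lam t x - x)) k‖ ≤ ‖(lam k : ℂ) * b.repr x k‖ := by
  have h_repr : b.repr (t⁻¹ • (diagonalGroup b lam t x - x)) k =
      (t : ℂ)⁻¹ * ((cexp (I * (-(t * lam k) : ℝ)) - 1) * b.repr x k) := by
    rw [← Complex.coe_smul, map_smul, map_sub, lp.coeFn_smul, lp.coeFn_sub, Pi.smul_apply,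
      Pi.sub_apply, repr_diagonalGroup, smul_eq_mul, ofReal_inv, sub_one_mul]
  obtain rfl | ht := eq_or_ne t 0
  · simpa using mul_nonneg (abs_nonneg (lam k)) (norm_nonneg (b.repr x k))
  have h_exp : ‖cexp (I * (-(t * lam k) : ℝ)) - 1‖ ≤ |t| * |lam k| := by
    simpa using Real.norm_exp_I_mul_ofReal_sub_one_le (x := -(t * lam k))
  calc ‖b.repr (t⁻¹ • (diagonalGroup b lam t x - x)) k‖
      = |t|⁻¹ * (‖cexp (I * (-(t * lam k) : ℝ)) - 1‖ * ‖b.repr x k‖) := by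
        simp only [h_repr, norm_mul, norm_inv, norm_real, Real.norm_eq_abs]
    _ ≤ |t|⁻¹ * (|t| * |lam k| * ‖b.repr x k‖) := by gcongr
    _ = ‖(lam k : ℂ) * b.repr x k‖ := by
        rw [mul_assoc, inv_mul_cancel_left₀ (abs_ne_zero.mpr ht), norm_mul, norm_real,
          Real.norm_eq_abs]

theorem hasDerivAt_diagonalGroup_zero_iff (b : HilbertBasis ι ℂ H) (lam : ι → ℝ) (x y : H) :
    HasDerivAt (fun θ => diagonalGroup b lam θ x) (-(I • y)) 0 ↔
      ∀ k, b.repr y k = lam k * b.repr x k := by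
  have h_repr : ∀ k, b.repr (-(I • y)) k = -(I * b.repr y k) := fun k => by
    rw [map_neg, map_smul, lp.coeFn_neg, lp.coeFn_smul, Pi.neg_apply, Pi.smul_apply, smul_eq_mul]
  constructor
  · intro h k
    have h_coord : HasDerivAt (fun θ => b.repr (diagonalGroup b lam θ x) k)
        (b.repr (-(I • y)) k) 0 := by
      simp only [b.repr_apply_apply]
      exact ((innerSL ℂ (b k)).restrictScalars ℝ).hasFDerivAt.comp_hasDerivAt (0 : ℝ) h
    have := h_coord.unique (hasDerivAt_repr_diagonalGroup_zero b lam x k)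
    rwa [h_repr, neg_inj, mul_right_inj' I_ne_zero] at this
  · intro h
    rw [hasDerivAt_iff_tendsto_slope_zero]
    simp only [zero_add, diagonalGroup_zero, one_apply_eq_self]
    refine tendsto_of_forall_tendsto_repr b (z := y) (Eventually.of_forall fun t k => ?_)
      fun k => ?_
    · rw [h]
      exact norm_repr_slope_diagonalGroup_le b lam x t k
    · have := (hasDerivAt_repr_diagonalGroup_zero b lam x k).tendsto_slope_zero
      rw [h_repr, h]
      convert! this using 2 with t
      rw [← Complex.coe_smul, map_smul, map_sub, lp.coeFn_smul, lp.coeFn_sub, zero_add,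
        diagonalGroup_zero]
      simp

variable [CompleteSpace H]

theorem diagonalGroup_mem_unitary (b : HilbertBasis ι ℂ H) (lam : ι → ℝ) (θ : ℝ) :
    diagonalGroup b lam θ ∈ unitary (H →L[ℂ] H) :=
  (Unitary.linearIsometryEquiv.symm
    (diagonalUnitary b fun k => Circle.exp (-(θ * lam k)))).2

end DiagonalGroup

section OneParameterGroup

variable {E : Type*} [NormedAddCommGroup E] [NormedSpace ℂ E] {U : ℝ → E →L[ℂ] E}

theorem hasDerivAt_oneParameterGroup (h_add : ∀ s t, U (s + t) = U s * U t) {x y : E}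
    (h : HasDerivAt (fun s => U s x) y 0) (t : ℝ) : HasDerivAt (fun s => U s x) (U t y) t := by
  have h_shift : HasDerivAt (fun s => U (s - t) x) y t := by
    rw [← sub_self t] at h
    exact h.comp_sub_const t t
  have h_mul : ∀ s, U s x = U t (U (s - t) x) := fun s => by
    rw [← mul_apply_eq_comp, ← h_add, add_sub_cancel]
  exact (((U t).restrictScalars ℝ).hasFDerivAt.comp_hasDerivAt t h_shift).congr_of_eventuallyEq
    (Eventually.of_forall h_mul)

theorem oneParameterGroup_apply_of_hasDerivAt_smul (h_zero : U 0 = 1)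
    (h_add : ∀ s t, U (s + t) = U s * U t) {x : E} {c : ℂ}
    (h : HasDerivAt (fun s => U s x) (c • x) 0) (t : ℝ) : U t x = cexp (t * c) • x := by
  have h_exp : ∀ s : ℝ, HasDerivAt (fun s : ℝ => cexp (s * -c)) (cexp (s * -c) * -c) s :=
    fun s => by
      simpa using ((hasDerivAt_id s).ofReal_comp.mul_const (-c)).cexp
  have h_deriv : ∀ s : ℝ, HasDerivAt (fun s : ℝ => cexp (s * -c) • U s x) 0 s := fun s => by
    convert! (h_exp s).smul (hasDerivAt_oneParameterGroup h_add h s) using 1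
    rw [map_smul]
    module
  have h_const : cexp (t * -c) • U t x = x := by
    simpa [h_zero] using is_const_of_deriv_eq_zero (fun s => (h_deriv s).differentiableAt)
      (fun s => (h_deriv s).deriv) t 0
  calc U t x = cexp (t * c) • cexp (t * -c) • U t x := by
        rw [smul_smul, ← Complex.exp_add, mul_neg, add_neg_cancel, Complex.exp_zero, one_smul]
    _ = cexp (t * c) • x := by rw [h_const]

end OneParameterGroup

section Diagonalization

variable {ι 𝕜 H : Type*} [RCLike 𝕜] [NormedAddCommGroup H] [InnerProductSpace 𝕜 H]

theorem coe_topologicalClosure_eq_of_symmetric (b : HilbertBasis ι 𝕜 H) (lam : ι → ℝ)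
    {G : Submodule 𝕜 (H × H)} (hG : ∀ p ∈ G, ∀ q ∈ G, inner 𝕜 p.2 q.1 = inner 𝕜 p.1 q.2)
    (hb : ∀ k, (b k, (lam k : 𝕜) • b k) ∈ G) :
    (G.topologicalClosure : Set (H × H)) = {p | ∀ k, b.repr p.2 k = lam k * b.repr p.1 k} := by
  refine Set.Subset.antisymm ?_ ?_
  · rw [Submodule.topologicalClosure_coe]
    refine closure_minimal (fun p hp k => ?_) ?_
    · have h := hG _ (hb k) p hp
      rw [inner_smul_left, RCLike.conj_ofReal] at h
      rw [b.repr_apply_apply, b.repr_apply_apply, ← h]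
    · simp only [b.repr_apply_apply, Set.ofPred_forall]
      exact isClosed_iInter fun k => isClosed_eq (by fun_prop) (by fun_prop)
  · intro p hp
    refine G.isClosed_topologicalClosure.mem_of_tendsto
      ((b.hasSum_repr p.1).prodMk (b.hasSum_repr p.2)) (Eventually.of_forall fun s => ?_)
    refine Submodule.le_topologicalClosure _ (Submodule.sum_mem _ fun k _ => ?_)
    have h_smul := G.smul_mem (b.repr p.1 k) (hb k)
    rwa [Prod.smul_mk, smul_smul, mul_comm, ← hp k] at h_smul

variable [CompleteSpace H] {V : ι → Submodule 𝕜 H}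

theorem exists_hilbertBasis_sigma {α : ι → Type*} [∀ i, Fintype (α i)]
    (hV : OrthogonalFamily 𝕜 (fun i => V i) fun i => (V i).subtypeₗᵢ) (hV_top : (⨆ i, V i)ᗮ = ⊥)
    (B : ∀ i, OrthonormalBasis (α i) 𝕜 (V i)) :
    ∃ b : HilbertBasis (Σ i, α i) 𝕜 H, ∀ k, b k = B k.1 k.2 := by
  have h_orthonormal := hV.orthonormal_sigma_orthonormal fun i => (B i).orthonormal
  have h_le : ∀ i, V i ≤ Submodule.span 𝕜 (Set.range fun k : Σ i, α i => (B k.1 k.2 : H)) := by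
    intro i x hx
    have h_sum : ((∑ a, (B i).repr ⟨x, hx⟩ a • B i a : V i) : H) = x :=
      congrArg Subtype.val ((B i).sum_repr ⟨x, hx⟩)
    rw [← h_sum, Submodule.coe_sum]
    exact Submodule.sum_mem _ fun a _ =>
      Submodule.smul_mem _ _ (Submodule.subset_span ⟨⟨i, a⟩, rfl⟩)
  refine ⟨HilbertBasis.mkOfOrthogonalEqBot h_orthonormal ?_, fun k => ?_⟩
  · exact eq_bot_mono (Submodule.orthogonal_le (iSup_le h_le)) hV_top
  · rw [HilbertBasis.coe_mkOfOrthogonalEqBot]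
    rfl

theorem exists_hilbertBasis_eigenvectors [∀ i, FiniteDimensional 𝕜 (V i)]
    (hV : OrthogonalFamily 𝕜 (fun i => V i) fun i => (V i).subtypeₗᵢ) (hV_top : (⨆ i, V i)ᗮ = ⊥)
    {T : ∀ i, V i →ₗ[𝕜] V i} (hT : ∀ i, (T i).IsSymmetric) :
    ∃ (b : HilbertBasis (Σ i, Fin (Module.finrank 𝕜 (V i))) 𝕜 H)
      (lam : (Σ i, Fin (Module.finrank 𝕜 (V i))) → ℝ),
      ∀ k, ∃ v : V k.1, (v : H) = b k ∧ T k.1 v = (lam k : 𝕜) • v := by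
  obtain ⟨b, hb⟩ := exists_hilbertBasis_sigma hV hV_top fun i => (hT i).eigenvectorBasis rfl
  exact ⟨b, fun k => (hT k.1).eigenvalues rfl k.2, fun k =>
    ⟨_, (hb k).symm, (hT k.1).apply_eigenvectorBasis rfl k.2⟩⟩

end Diagonalization

section MomentDeterminacy

open FourierTransform

variable {E F : Type*} [NormedAddCommGroup E] [InnerProductSpace ℝ E] [MeasurableSpace E]
  [BorelSpace E] [NormedAddCommGroup F] [NormedSpace ℂ F]

theorem integral_schwartzMap_smul_eq_integral_fourierInv_smul_fourier [FiniteDimensional ℝ E]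
    [CompleteSpace F] (g : 𝓢(E, ℂ)) {h : E → F} (hh : Integrable h) :
    ∫ x, g x • h x = ∫ ξ, (𝓕⁻ g : 𝓢(E, ℂ)) ξ • 𝓕 h ξ := by
  have h_flip : ∫ x, 𝓕 ((𝓕⁻ g : 𝓢(E, ℂ)) : E → ℂ) x • h x =
      ∫ ξ, (𝓕⁻ g : 𝓢(E, ℂ)) ξ • 𝓕 h ξ := by
    have := VectorFourier.integral_fourierIntegral_smul_eq_flip (L := innerₗ E) (μ := volume)
      (ν := volume) Real.continuous_fourierChar continuous_inner (𝓕⁻ g : 𝓢(E, ℂ)).integrable hh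
    rwa [flip_innerₗ] at this
  rwa [← SchwartzMap.fourier_coe, FourierTransform.fourier_fourierInv_eq] at h_flip

theorem ae_eq_zero_of_fourier_eq_zero [FiniteDimensional ℝ E] [CompleteSpace F] {h : E → F}
    (hh : Integrable h) (h_fourier : ∀ ξ, 𝓕 h ξ = 0) : h =ᵐ[volume] 0 := by
  refine ae_eq_zero_of_integral_contDiff_smul_eq_zero hh.locallyIntegrable fun g hg hg_supp => ?_
  have hc_supp : HasCompactSupport (Complex.ofRealCLM ∘ g) := hg_supp.comp_left rfl
  have hc : ContDiff ℝ ((⊤ : ℕ∞) : WithTop ℕ∞) (Complex.ofRealCLM ∘ g) :=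
    Complex.ofRealCLM.contDiff.comp hg
  have h_pair := integral_schwartzMap_smul_eq_integral_fourierInv_smul_fourier
    (hc_supp.toSchwartzMap hc) hh
  simpa [h_fourier] using h_pair

theorem hasSum_integral_inner_pow_smul {μ : Measure E} {h : E → F}
    (hh : AEStronglyMeasurable h μ) (ξ : E)
    (h_exp : Integrable (fun x => Real.exp (‖ξ‖ * ‖x‖) * ‖h x‖) μ) :
    HasSum (fun k : ℕ => (I ^ k / (k.factorial : ℂ)) • ∫ x, ((inner ℝ ξ x : ℝ) : ℂ) ^ k • h x ∂μ)
      (∫ x, cexp ((inner ℝ ξ x : ℝ) * I) • h x ∂μ) := by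
  have h_term : ∀ (k : ℕ) (x : E), (((inner ℝ ξ x : ℝ) * I) ^ k / (k.factorial : ℂ)) • h x =
      (I ^ k / (k.factorial : ℂ)) • ((inner ℝ ξ x : ℝ) : ℂ) ^ k • h x := fun k x => by
    rw [smul_smul, mul_pow]
    ring_nf
  simp only [← integral_smul, ← h_term]
  refine hasSum_integral_of_dominated_convergence
    (fun k x => (‖ξ‖ * ‖x‖) ^ k / (k.factorial : ℝ) * ‖h x‖) (fun k => ?_)
    (fun k => Eventually.of_forall fun x => ?_)
    (Eventually.of_forall fun x => (Real.summable_pow_div_factorial (‖ξ‖ * ‖x‖)).mul_right _)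
    ?_ (Eventually.of_forall fun x => ?_)
  · exact (Continuous.aestronglyMeasurable (by fun_prop)).smul hh
  · rw [norm_smul, norm_div, norm_pow, norm_mul, norm_I, mul_one, norm_real, norm_natCast]
    gcongr
    exact norm_inner_le_norm ξ x
  · simpa only [tsum_mul_right, Real.exp_eq_exp_ℝ, NormedSpace.exp_eq_tsum_div] using h_exp
  · rw [Complex.exp_eq_exp_ℂ]
    exact (NormedSpace.expSeries_div_hasSum_exp _).smul_const (h x)

theorem ae_eq_zero_of_forall_integral_inner_pow_smul_eq_zero [FiniteDimensional ℝ E]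
    [CompleteSpace F] {h : E → F} (hh : AEStronglyMeasurable h)
    (h_exp : ∀ c : ℝ, Integrable fun x => Real.exp (c * ‖x‖) * ‖h x‖)
    (h_moment : ∀ (ξ : E) (k : ℕ), ∫ x, ((inner ℝ ξ x : ℝ) : ℂ) ^ k • h x = 0) :
    h =ᵐ[volume] 0 := by
  have h_char : ∀ ξ : E, ∫ x, cexp ((inner ℝ ξ x : ℝ) * I) • h x = 0 := fun ξ => by
    have h_sum := hasSum_integral_inner_pow_smul hh ξ (h_exp ‖ξ‖)
    simp only [h_moment, smul_zero] at h_sum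
    exact h_sum.unique hasSum_zero
  have h_int : Integrable h := (integrable_norm_iff hh).mp (by simpa using h_exp 0)
  refine ae_eq_zero_of_fourier_eq_zero h_int fun ξ => ?_
  rw [Real.fourier_eq', ← h_char (-(2 * Real.pi) • ξ)]
  refine integral_congr_ae (Eventually.of_forall fun x => ?_)
  simp only [real_inner_smul_left, real_inner_comm x ξ, neg_mul]

end MomentDeterminacy

section GaussianSchwartz

variable {E : Type*} [NormedAddCommGroup E] [InnerProductSpace ℝ E]

theorem hasTemperateGrowth_neg_half_norm_sq : (fun x : E => -(‖x‖ ^ 2 / 2)).HasTemperateGrowth := by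
  have := (Function.HasTemperateGrowth.const (E := E) (-(1 / 2) : ℝ)).mul
    (Function.hasTemperateGrowth_norm_sq (H := E))
  convert! this using 2
  rw [Pi.mul_apply]
  ring

theorem one_add_pow_mul_exp_neg_half_sq_le (p : ℕ) {r : ℝ} (hr : 0 ≤ r) :
    (1 + r) ^ p * Real.exp (-(r ^ 2 / 2)) ≤ p.factorial * Real.exp (3 / 2) := by
  have h_pow := Real.pow_div_factorial_le_exp (x := 1 + r) (by positivity) p
  rw [div_le_iff₀ (by positivity)] at h_pow
  calc (1 + r) ^ p * Real.exp (-(r ^ 2 / 2))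
      ≤ Real.exp (1 + r) * p.factorial * Real.exp (-(r ^ 2 / 2)) := by gcongr
    _ = p.factorial * Real.exp (1 + r - r ^ 2 / 2) := by
        rw [sub_eq_add_neg, Real.exp_add (1 + r)]
        ring
    _ ≤ p.factorial * Real.exp (3 / 2) := by
        gcongr
        nlinarith [sq_nonneg (r - 1)]

theorem exists_norm_iteratedFDeriv_gaussian_le (m : ℕ) :
    ∃ (p : ℕ) (C : ℝ), 0 ≤ C ∧ ∀ x : E,
      ‖iteratedFDeriv ℝ m (fun x : E => Real.exp (-(‖x‖ ^ 2 / 2))) x‖ ≤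
        C * ((1 + ‖x‖) ^ p * Real.exp (-(‖x‖ ^ 2 / 2))) := by
  have h_growth := hasTemperateGrowth_neg_half_norm_sq (E := E)
  obtain ⟨p, C, hC, h_le⟩ := h_growth.norm_iteratedFDeriv_le_uniform m
  refine ⟨p * m, m.factorial * (1 + C) ^ m, by positivity, fun x => ?_⟩
  have h_one_le : 1 ≤ (1 + C) * (1 + ‖x‖) ^ p :=
    one_le_mul_of_one_le_of_one_le (by linarith) (one_le_pow₀ (by linarith [norm_nonneg x]))
  have h_exp : ∀ i ≤ m, ‖iteratedFDeriv ℝ i Real.exp (-(‖x‖ ^ 2 / 2))‖ ≤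
      Real.exp (-(‖x‖ ^ 2 / 2)) := fun i _ => by
    rw [norm_iteratedFDeriv_eq_norm_iteratedDeriv, iteratedDeriv_eq_iterate, Real.iter_deriv_exp,
      Real.norm_eq_abs, Real.abs_exp]
  have h_quad : ∀ i, 1 ≤ i → i ≤ m → ‖iteratedFDeriv ℝ i (fun x : E => -(‖x‖ ^ 2 / 2)) x‖ ≤
      ((1 + C) * (1 + ‖x‖) ^ p) ^ i := fun i hi him => by
    calc ‖iteratedFDeriv ℝ i (fun x : E => -(‖x‖ ^ 2 / 2)) x‖
        ≤ C * (1 + ‖x‖) ^ p := h_le i him x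
      _ ≤ (1 + C) * (1 + ‖x‖) ^ p := by gcongr; linarith
      _ ≤ ((1 + C) * (1 + ‖x‖) ^ p) ^ i := le_self_pow₀ h_one_le (by omega)
  calc ‖iteratedFDeriv ℝ m (fun x : E => Real.exp (-(‖x‖ ^ 2 / 2))) x‖
      ≤ m.factorial * Real.exp (-(‖x‖ ^ 2 / 2)) * ((1 + C) * (1 + ‖x‖) ^ p) ^ m :=
        norm_iteratedFDeriv_comp_le Real.contDiff_exp h_growth.1
          (N := ((⊤ : ℕ∞) : WithTop ℕ∞)) (by exact_mod_cast le_top) x h_exp h_quad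
    _ = m.factorial * (1 + C) ^ m * ((1 + ‖x‖) ^ (p * m) * Real.exp (-(‖x‖ ^ 2 / 2))) := by
        rw [mul_pow, ← pow_mul]
        ring

theorem exists_norm_pow_mul_iteratedFDeriv_gaussian_le (k m : ℕ) :
    ∃ C : ℝ, ∀ x : E,
      ‖x‖ ^ k * ‖iteratedFDeriv ℝ m (fun x : E => Real.exp (-(‖x‖ ^ 2 / 2))) x‖ ≤ C := by
  obtain ⟨p, C, hC, h_le⟩ := exists_norm_iteratedFDeriv_gaussian_le (E := E) m
  refine ⟨C * ((k + p).factorial * Real.exp (3 / 2)), fun x => ?_⟩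
  calc ‖x‖ ^ k * ‖iteratedFDeriv ℝ m (fun x : E => Real.exp (-(‖x‖ ^ 2 / 2))) x‖
      ≤ (1 + ‖x‖) ^ k * (C * ((1 + ‖x‖) ^ p * Real.exp (-(‖x‖ ^ 2 / 2)))) := by
        gcongr
        · linarith
        · exact h_le x
    _ = C * ((1 + ‖x‖) ^ (k + p) * Real.exp (-(‖x‖ ^ 2 / 2))) := by
        rw [pow_add]
        ring
    _ ≤ C * ((k + p).factorial * Real.exp (3 / 2)) :=
        mul_le_mul_of_nonneg_left (one_add_pow_mul_exp_neg_half_sq_le _ (norm_nonneg x)) hC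

/-- The Gaussian `exp(-‖x‖² / 2)` as a Schwartz function; the vacuum of the qumodes is a multiple
of it. -/
def gaussianSchwartz (E : Type*) [NormedAddCommGroup E] [InnerProductSpace ℝ E] : 𝓢(E, ℝ) where
  toFun x := Real.exp (-(‖x‖ ^ 2 / 2))
  smooth' := Real.contDiff_exp.comp hasTemperateGrowth_neg_half_norm_sq.1
  decay' := exists_norm_pow_mul_iteratedFDeriv_gaussian_le

theorem gaussianSchwartz_apply (x : E) : gaussianSchwartz E x = Real.exp (-(‖x‖ ^ 2 / 2)) := rfl

theorem hasFDerivAt_gaussianSchwartz (x : E) :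
    HasFDerivAt (gaussianSchwartz E) (-(gaussianSchwartz E x • innerSL ℝ x)) x := by
  have h_exponent : HasFDerivAt (fun y : E => -(‖y‖ ^ 2 / 2)) (-innerSL ℝ x) x := by
    convert! ((hasStrictFDerivAt_norm_sq x).hasFDerivAt.const_mul (1 / 2)).fun_neg using 2
    · ring
    · module
  convert! h_exponent.exp using 1
  rw [smul_neg, gaussianSchwartz_apply]

theorem memLp_exp_mul_norm_mul_gaussianSchwartz [FiniteDimensional ℝ E] [MeasurableSpace E]
    [BorelSpace E] (c : ℝ) :
    MemLp (fun x => Real.exp (c * ‖x‖) * gaussianSchwartz E x) 2 := by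
  have h_cont : Continuous fun x => Real.exp (c * ‖x‖) * gaussianSchwartz E x :=
    Continuous.mul (by fun_prop) (gaussianSchwartz E).continuous
  rw [memLp_two_iff_integrable_sq h_cont.aestronglyMeasurable]
  refine Integrable.mono' ((gaussianSchwartz E).integrable.const_mul (Real.exp (2 * c ^ 2)))
    (h_cont.pow 2).aestronglyMeasurable (Eventually.of_forall fun x => ?_)
  rw [gaussianSchwartz_apply, Real.norm_eq_abs, abs_of_nonneg (by positivity), ← Real.exp_add,
    ← Real.exp_add, ← Real.exp_nat_mul, Real.exp_le_exp]
  push_cast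
  nlinarith [sq_nonneg (‖x‖ - 2 * c)]

end GaussianSchwartz

section GaussianMoments

variable {E F : Type*} [NormedAddCommGroup E] [InnerProductSpace ℝ E] [FiniteDimensional ℝ E]
  [MeasurableSpace E] [BorelSpace E] [NormedAddCommGroup F] [NormedSpace ℂ F]

theorem integrable_exp_mul_norm_mul_gaussianSchwartz_smul (f : Lp F 2 (volume : Measure E))
    (c : ℝ) : Integrable fun x => Real.exp (c * ‖x‖) * ‖(gaussianSchwartz E x : ℂ) • f x‖ := by
  refine ((memLp_exp_mul_norm_mul_gaussianSchwartz c).integrable_mul (Lp.memLp f).norm).congr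
    (Eventually.of_forall fun x => ?_)
  simp only [Pi.mul_apply, norm_smul, norm_real, gaussianSchwartz_apply, Real.norm_eq_abs,
    Real.abs_exp, mul_assoc]

variable [CompleteSpace F]

theorem eq_zero_of_forall_integral_inner_pow_smul_gaussianSchwartz_smul_eq_zero
    {f : Lp F 2 (volume : Measure E)}
    (h_moment : ∀ (ξ : E) (k : ℕ),
      ∫ x, ((inner ℝ ξ x : ℝ) : ℂ) ^ k • (gaussianSchwartz E x : ℂ) • f x = 0) : f = 0 := by
  have h_meas : AEStronglyMeasurable (fun x => (gaussianSchwartz E x : ℂ) • f x) volume :=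
    (continuous_ofReal.comp (gaussianSchwartz E).continuous).aestronglyMeasurable.smul
      (Lp.memLp f).aestronglyMeasurable
  rw [Lp.eq_zero_iff_ae_eq_zero]
  filter_upwards [ae_eq_zero_of_forall_integral_inner_pow_smul_eq_zero h_meas
    (integrable_exp_mul_norm_mul_gaussianSchwartz_smul f) h_moment] with x hx
  refine (smul_eq_zero.mp hx).resolve_left ?_
  rw [gaussianSchwartz_apply]
  exact_mod_cast (Real.exp_pos _).ne'

end GaussianMoments

section SchwartzDerivatives

variable {E F : Type*} [NormedAddCommGroup E] [NormedSpace ℝ E] [NormedAddCommGroup F]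
  [NormedSpace ℝ F]

theorem lineDerivOp_lineDerivOp_apply (v w : E) (ψ : 𝓢(E, F)) (x : E) :
    (∂_{v} (∂_{w} ψ) : 𝓢(E, F)) x = fderiv ℝ (fderiv ℝ ψ) x v w := by
  have h_lineDeriv : ((∂_{w} ψ : 𝓢(E, F)) : E → F) = fun y => fderiv ℝ ψ y w :=
    funext fun y => SchwartzMap.lineDerivOp_apply_eq_fderiv w ψ y
  have h_diff : DifferentiableAt ℝ (fderiv ℝ ψ) x :=
    ((ψ.smooth 2).fderiv_right (m := 1) (by norm_num)).differentiable (by norm_num) x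
  rw [SchwartzMap.lineDerivOp_apply_eq_fderiv, h_lineDeriv,
    (h_diff.hasFDerivAt.clm_apply (hasFDerivAt_const w x)).fderiv]
  simp

theorem lineDerivOp_comm (v w : E) (ψ : 𝓢(E, F)) : ∂_{v} (∂_{w} ψ) = ∂_{w} (∂_{v} ψ) := by
  ext x
  rw [lineDerivOp_lineDerivOp_apply, lineDerivOp_lineDerivOp_apply]
  exact ((ψ.smooth 2).contDiffAt.isSymmSndFDerivAt (by simp)).eq v w

end SchwartzDerivatives

theorem apply_apply_eq_add_of_lie_eq {R M : Type*} [CommRing R] [AddCommGroup M] [Module R M]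
    {A B C : Module.End R M} (h : ⁅A, B⁆ = C) (x : M) : A (B x) = B (A x) + C x := by
  rw [← h, Ring.lie_def, LinearMap.sub_apply, Module.End.mul_apply, Module.End.mul_apply,
    add_sub_cancel]

namespace Qumode

variable {n : ℕ}

/-- `toState` as a linear map. -/
def toStateₗ (n : ℕ) : 𝓢(Pos n, ℂ) →ₗ[ℂ] Hilb n :=
  (SchwartzMap.toLpCLM ℂ ℂ 2 (volume : Measure (Pos n))).toLinearMap

theorem toStateₗ_apply (ψ : 𝓢(Pos n, ℂ)) : toStateₗ n ψ = toState ψ := rfl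

theorem toState_add (ψ χ : 𝓢(Pos n, ℂ)) : toState (ψ + χ) = toState ψ + toState χ :=
  map_add (toStateₗ n) ψ χ

theorem toState_smul (c : ℂ) (ψ : 𝓢(Pos n, ℂ)) : toState (c • ψ) = c • toState ψ :=
  map_smul (toStateₗ n) c ψ

theorem toStateₗ_injective : Function.Injective (toStateₗ n) :=
  SchwartzMap.injective_toLp 2 volume

theorem inner_toState (ψ χ : 𝓢(Pos n, ℂ)) :
    inner ℂ (toState ψ) (toState χ) = ∫ x, inner ℂ (ψ x) (χ x) :=
  SchwartzMap.inner_toL2_toL2_eq ψ χ volume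

section FormalAdjoint

/-- `B` is the adjoint of `A` on the Schwartz space, for the inner product of the state space. -/
def IsFormalAdjoint (A B : Op n) : Prop :=
  ∀ ψ χ, inner ℂ (toState (A ψ)) (toState χ) = inner ℂ (toState ψ) (toState (B χ))

namespace IsFormalAdjoint

variable {A A' B B' : Op n}

theorem symm (h : IsFormalAdjoint A B) : IsFormalAdjoint B A := fun ψ χ => by
  rw [← inner_conj_symm, ← h, inner_conj_symm]

theorem add (h : IsFormalAdjoint A B) (h' : IsFormalAdjoint A' B') :
    IsFormalAdjoint (A + A') (B + B') := fun ψ χ => by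
  rw [LinearMap.add_apply, LinearMap.add_apply, toState_add, toState_add, inner_add_left,
    inner_add_right, h, h']

theorem smul (h : IsFormalAdjoint A B) (c : ℂ) :
    IsFormalAdjoint (c • A) (starRingEnd ℂ c • B) := fun ψ χ => by
  rw [LinearMap.smul_apply, LinearMap.smul_apply, toState_smul, toState_smul, inner_smul_left,
    inner_smul_right, h]

theorem mul (h : IsFormalAdjoint A B) (h' : IsFormalAdjoint A' B') :
    IsFormalAdjoint (A * A') (B' * B) := fun ψ χ => by
  rw [Module.End.mul_apply, Module.End.mul_apply, h, h']

theorem sum {ι : Type*} {s : Finset ι} {A B : ι → Op n}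
    (h : ∀ i ∈ s, IsFormalAdjoint (A i) (B i)) : IsFormalAdjoint (∑ i ∈ s, A i) (∑ i ∈ s, B i) :=
  fun ψ χ => by
    simp only [LinearMap.sum_apply, ← toStateₗ_apply, map_sum, sum_inner, inner_sum]
    exact Finset.sum_congr rfl fun i hi => h i hi ψ χ

theorem inner_eq_zero_of_eigenvalue_ne (hA : IsFormalAdjoint A A) {ψ χ : 𝓢(Pos n, ℂ)} {a b : ℝ}
    (hab : a ≠ b) (hψ : A ψ = (a : ℂ) • ψ) (hχ : A χ = (b : ℂ) • χ) :
    inner ℂ (toState ψ) (toState χ) = 0 := by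
  have h := hA ψ χ
  rw [hψ, hχ, toState_smul, toState_smul, inner_smul_left, inner_smul_right, conj_ofReal] at h
  exact (mul_eq_mul_right_iff.mp h).resolve_left (ofReal_injective.ne hab)

end IsFormalAdjoint

theorem isFormalAdjoint_position (j : Fin n) : IsFormalAdjoint (position j) (position j) := by
  intro ψ χ
  rw [inner_toState, inner_toState]
  congr 1 with x
  simp only [position_apply, RCLike.inner_apply, map_mul, conj_ofReal]
  ring

theorem isFormalAdjoint_momentum (j : Fin n) : IsFormalAdjoint (momentum j) (momentum j) := by
  intro ψ χ
  let v : Pos n := EuclideanSpace.single j 1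
  let L : ℂ →L[ℝ] ℂ →L[ℝ] ℂ := (ContinuousLinearMap.mul ℝ ℂ).comp (conjCLE : ℂ →L[ℝ] ℂ)
  have hL : ∀ z w, L z w = starRingEnd ℂ z * w := fun _ _ => rfl
  have h_left : ∀ x, inner ℂ (momentum j ψ x) (χ x) = I * L ((∂_{v} ψ : 𝓢(Pos n, ℂ)) x) (χ x) :=
    fun x => by
      simp only [hL, momentum_apply, SchwartzMap.lineDerivOp_apply_eq_fderiv, RCLike.inner_apply,
        map_mul, map_neg, conj_I, v]
      ring
  have h_right : ∀ x, inner ℂ (ψ x) (momentum j χ x) = -I * L (ψ x) ((∂_{v} χ : 𝓢(Pos n, ℂ)) x) :=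
    fun x => by
      simp only [hL, momentum_apply, SchwartzMap.lineDerivOp_apply_eq_fderiv, RCLike.inner_apply,
        v]
      ring
  simp only [inner_toState, h_left, h_right]
  rw [integral_const_mul, integral_const_mul,
    SchwartzMap.integral_bilinear_lineDerivOp_right_eq_neg_left (μ := volume) ψ χ L v]
  ring

theorem isFormalAdjoint_creat_annih (j : Fin n) : IsFormalAdjoint (creat j) (annih j) := by
  have h := ((isFormalAdjoint_position j).add ((isFormalAdjoint_momentum j).smul (-I))).smul
    ((1 / Real.sqrt 2 : ℝ) : ℂ)
  rwa [conj_ofReal, map_neg, conj_I, neg_neg, neg_smul, ← sub_eq_add_neg] at h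

theorem isFormalAdjoint_quadHamiltonian (P : Matrix (Fin n) (Fin n) ℂ) :
    IsFormalAdjoint (quadHamiltonian P) (quadHamiltonian Pᴴ) := by
  have h : IsFormalAdjoint (quadHamiltonian P)
      (∑ i, ∑ j, starRingEnd ℂ (P i j) • (creat j * annih i)) :=
    .sum fun i _ => .sum fun j _ =>
      ((isFormalAdjoint_creat_annih i).mul (isFormalAdjoint_creat_annih j).symm).smul (P i j)
  rwa [Finset.sum_comm] at h

theorem isFormalAdjoint_quadHamiltonian_of_isHermitian {P : Matrix (Fin n) (Fin n) ℂ}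
    (hP : P.IsHermitian) : IsFormalAdjoint (quadHamiltonian P) (quadHamiltonian P) := by
  simpa only [hP.eq] using isFormalAdjoint_quadHamiltonian P

theorem quadHamiltonian_one : quadHamiltonian (1 : Matrix (Fin n) (Fin n) ℂ) = totalNumber n := by
  simp [quadHamiltonian, totalNumber, Matrix.one_apply, ite_smul]

theorem isFormalAdjoint_totalNumber : IsFormalAdjoint (totalNumber n) (totalNumber n) := by
  simpa only [quadHamiltonian_one] using
    isFormalAdjoint_quadHamiltonian_of_isHermitian (Matrix.isHermitian_one (n := Fin n) (α := ℂ))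

end FormalAdjoint

section CommutationRelations

attribute [local instance] LieRing.ofAssociativeRing

theorem lie_position_position (i j : Fin n) : ⁅position i, position j⁆ = 0 := by
  rw [Ring.lie_def, sub_eq_zero]
  ext ψ x
  simp only [Module.End.mul_apply, position_apply]
  ring

theorem lie_momentum_momentum (i j : Fin n) : ⁅momentum i, momentum j⁆ = 0 := by
  rw [momentum, momentum, smul_lie, lie_smul, Ring.lie_def, sub_eq_zero.mpr, smul_zero, smul_zero]
  exact LinearMap.ext (lineDerivOp_comm _ _)

theorem lie_position_momentum (i j : Fin n) :
    ⁅position i, momentum j⁆ = (if i = j then I else 0) • (1 : Op n) := by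
  ext ψ x
  have h_coord : HasFDerivAt (fun y : Pos n => (y i : ℂ))
      (ofRealCLM.comp (EuclideanSpace.proj i : Pos n →L[ℝ] ℝ)) x :=
    (ofRealCLM.comp (EuclideanSpace.proj i : Pos n →L[ℝ] ℝ)).hasFDerivAt
  have h_position : (position i ψ : Pos n → ℂ) = fun y => (y i : ℂ) * ψ y :=
    funext (position_apply i ψ)
  have h_deriv := (h_coord.fun_mul (ψ.differentiable x).hasFDerivAt).fderiv
  simp only [Ring.lie_def, LinearMap.sub_apply, LinearMap.smul_apply, Module.End.mul_apply,
    Module.End.one_apply, _root_.sub_apply, _root_.smul_apply, position_apply, momentum_apply,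
    h_position, h_deriv]
  simp only [_root_.add_apply, _root_.smul_apply, smul_eq_mul, ContinuousLinearMap.comp_apply,
    PiLp.proj_apply, PiLp.single_apply, ofRealCLM_apply]
  split_ifs <;> push_cast <;> ring

theorem lie_momentum_position (i j : Fin n) :
    ⁅momentum i, position j⁆ = -((if i = j then I else 0) • (1 : Op n)) := by
  rw [← lie_skew, lie_position_momentum, if_congr eq_comm rfl rfl]

theorem one_div_sqrt_two_mul_self :
    ((1 / Real.sqrt 2 : ℝ) : ℂ) * ((1 / Real.sqrt 2 : ℝ) : ℂ) = 1 / 2 := by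
  rw [← ofReal_mul, div_mul_div_comm, Real.mul_self_sqrt zero_le_two]
  norm_num

theorem lie_annih_creat (i j : Fin n) :
    ⁅annih i, creat j⁆ = (if i = j then (1 : ℂ) else 0) • (1 : Op n) := by
  rw [annih, creat, smul_lie, lie_smul, smul_smul, one_div_sqrt_two_mul_self]
  simp only [add_lie, lie_sub, smul_lie, lie_smul, lie_position_position, lie_momentum_momentum,
    lie_position_momentum, lie_momentum_position]
  split_ifs
  · match_scalars
    linear_combination -I_sq
  · simp

theorem lie_creat_creat (i j : Fin n) : ⁅creat i, creat j⁆ = 0 := by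
  simp only [creat, sub_lie, lie_sub, smul_lie, lie_smul, lie_position_position,
    lie_momentum_momentum, lie_position_momentum, lie_momentum_position]
  module

theorem lie_creat_mul_annih_creat (i j k : Fin n) :
    ⁅creat i * annih j, creat k⁆ = (if j = k then (1 : ℂ) else 0) • creat i := by
  have h_leibniz : ⁅creat i * annih j, creat k⁆ =
      creat i * ⁅annih j, creat k⁆ + ⁅creat i, creat k⁆ * annih j := by
    simp only [Ring.lie_def]
    noncomm_ring
  rw [h_leibniz, lie_annih_creat, lie_creat_creat, zero_mul, add_zero, mul_smul_comm, mul_one]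

theorem lie_totalNumber_creat (k : Fin n) : ⁅totalNumber n, creat k⁆ = creat k := by
  simp [totalNumber, sum_lie, lie_creat_mul_annih_creat]

theorem position_eq_smul_creat_add_annih (j : Fin n) :
    position j = ((1 / Real.sqrt 2 : ℝ) : ℂ) • (creat j + annih j) := by
  rw [creat, annih, ← smul_add, smul_smul, one_div_sqrt_two_mul_self]
  module

end CommutationRelations

section Vacuum

/-- The (unnormalized) vacuum wavefunction `exp(-‖q‖² / 2)`. -/
def vacuum (n : ℕ) : 𝓢(Pos n, ℂ) :=
  SchwartzMap.postcompCLM ofRealCLM (gaussianSchwartz (Pos n))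

theorem vacuum_apply (x : Pos n) : vacuum n x = (gaussianSchwartz (Pos n) x : ℂ) := rfl

theorem annih_vacuum (j : Fin n) : annih j (vacuum n) = 0 := by
  ext x
  have h_deriv : fderiv ℝ (vacuum n) x (EuclideanSpace.single j (1 : ℝ)) =
      -((x j : ℂ) * (gaussianSchwartz (Pos n) x : ℂ)) := by
    have h_fderiv : fderiv ℝ (vacuum n) x = _ :=
      (ofRealCLM.hasFDerivAt.comp x (hasFDerivAt_gaussianSchwartz x)).fderiv
    simp [h_fderiv, EuclideanSpace.inner_single_right, mul_comm]
  simp only [annih, LinearMap.smul_apply, LinearMap.add_apply, _root_.smul_apply,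
    _root_.add_apply, position_apply, momentum_apply, h_deriv, vacuum_apply, smul_eq_mul,
    _root_.zero_apply]
  linear_combination
    ((1 / Real.sqrt 2 : ℝ) : ℂ) * (x j : ℂ) * (gaussianSchwartz (Pos n) x : ℂ) * I_sq

/-- Multiplication by the linear form `⟪ξ, q⟫`. -/
def linearPosition (ξ : Pos n) : Op n := ∑ j, (ξ j : ℂ) • position j

theorem linearPosition_apply (ξ : Pos n) (ψ : 𝓢(Pos n, ℂ)) (x : Pos n) :
    linearPosition ξ ψ x = (inner ℝ ξ x : ℝ) * ψ x := by
  simp [linearPosition, PiLp.inner_apply, position_apply, LinearMap.sum_apply,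
    _root_.sum_apply, Finset.sum_mul, mul_comm (x.ofLp _), mul_assoc]

theorem linearPosition_pow_apply (ξ : Pos n) (k : ℕ) (ψ : 𝓢(Pos n, ℂ)) (x : Pos n) :
    (linearPosition ξ ^ k) ψ x = (inner ℝ ξ x : ℝ) ^ k * ψ x := by
  induction k with
  | zero => simp
  | succ k ih =>
    rw [pow_succ', Module.End.mul_apply, linearPosition_apply, ih]
    ring

theorem eq_zero_of_forall_inner_linearPosition_pow_vacuum_eq_zero {f : Hilb n}
    (hf : ∀ (ξ : Pos n) (k : ℕ), inner ℂ (toState ((linearPosition ξ ^ k) (vacuum n))) f = 0) :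
    f = 0 := by
  refine eq_zero_of_forall_integral_inner_pow_smul_gaussianSchwartz_smul_eq_zero fun ξ k => ?_
  rw [← hf ξ k, L2.inner_def]
  refine integral_congr_ae ?_
  filter_upwards [((linearPosition ξ ^ k) (vacuum n)).coeFn_toLp 2 volume] with x hx
  rw [toState, hx, linearPosition_pow_apply, vacuum_apply, RCLike.inner_apply, map_mul, map_pow,
    conj_ofReal, conj_ofReal, smul_eq_mul, smul_eq_mul]
  ring

end Vacuum

section PhotonLevel

/-- The wavefunctions of total photon number `m`: those obtained from the vacuum by creating `m`
photons. -/
def photonLevel (n : ℕ) : ℕ → Submodule ℂ 𝓢(Pos n, ℂ)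
  | 0 => Submodule.span ℂ {vacuum n}
  | m + 1 => ⨆ i : Fin n, (photonLevel n m).map (creat i)

instance finiteDimensional_photonLevel (m : ℕ) : FiniteDimensional ℂ (photonLevel n m) := by
  induction m with
  | zero => exact FiniteDimensional.span_singleton ℂ (vacuum n)
  | succ m ih =>
    exact inferInstanceAs
      (FiniteDimensional ℂ (⨆ i : Fin n, (photonLevel n m).map (creat i) : Submodule ℂ _))

theorem creat_mem_photonLevel (i : Fin n) {m : ℕ} {ψ : 𝓢(Pos n, ℂ)} (h : ψ ∈ photonLevel n m) :
    creat i ψ ∈ photonLevel n (m + 1) :=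
  Submodule.mem_iSup_of_mem i (Submodule.mem_map_of_mem h)

theorem photonLevel_zero_le_comap {A : Op n} {S : Submodule ℂ 𝓢(Pos n, ℂ)}
    (h : A (vacuum n) ∈ S) : photonLevel n 0 ≤ S.comap A :=
  (Submodule.span_singleton_le_iff_mem _ _).mpr h

theorem photonLevel_succ_le_comap {A : Op n} {S : Submodule ℂ 𝓢(Pos n, ℂ)} {m : ℕ}
    (h : ∀ k, ∀ χ ∈ photonLevel n m, A (creat k χ) ∈ S) :
    photonLevel n (m + 1) ≤ S.comap A :=
  iSup_le fun k => Submodule.map_le_iff_le_comap.mpr (h k)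

theorem photonLevel_le_comap_creat_mul_annih (i j : Fin n) (m : ℕ) :
    photonLevel n m ≤ (photonLevel n m).comap (creat i * annih j) := by
  induction m with
  | zero =>
    refine photonLevel_zero_le_comap ?_
    rw [Module.End.mul_apply, annih_vacuum, map_zero]
    exact Submodule.zero_mem _
  | succ m ih =>
    refine photonLevel_succ_le_comap fun k χ hχ => ?_
    rw [apply_apply_eq_add_of_lie_eq (lie_creat_mul_annih_creat i j k)]
    exact Submodule.add_mem _ (creat_mem_photonLevel k (ih hχ))
      (Submodule.smul_mem _ _ (creat_mem_photonLevel i hχ))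

theorem photonLevel_succ_le_comap_annih (j : Fin n) (m : ℕ) :
    photonLevel n (m + 1) ≤ (photonLevel n m).comap (annih j) := by
  refine photonLevel_succ_le_comap fun k χ hχ => ?_
  rw [apply_apply_eq_add_of_lie_eq (lie_annih_creat j k)]
  exact Submodule.add_mem _ (photonLevel_le_comap_creat_mul_annih k j m hχ)
    (Submodule.smul_mem _ _ hχ)

theorem quadHamiltonian_mem_photonLevel (P : Matrix (Fin n) (Fin n) ℂ) {m : ℕ}
    {ψ : 𝓢(Pos n, ℂ)} (hψ : ψ ∈ photonLevel n m) : quadHamiltonian P ψ ∈ photonLevel n m := by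
  simp only [quadHamiltonian, LinearMap.sum_apply, LinearMap.smul_apply]
  exact Submodule.sum_mem _ fun i _ => Submodule.sum_mem _ fun j _ =>
    Submodule.smul_mem _ _ (photonLevel_le_comap_creat_mul_annih i j m hψ)

theorem photonLevel_le_eigenspace_totalNumber (m : ℕ) :
    photonLevel n m ≤ (totalNumber n).eigenspace (m : ℂ) := by
  induction m with
  | zero =>
    refine (Submodule.span_singleton_le_iff_mem _ _).mpr (Module.End.mem_eigenspace_iff.mpr ?_)
    simp [totalNumber, LinearMap.sum_apply, annih_vacuum]
  | succ m ih =>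
    refine iSup_le fun k => Submodule.map_le_iff_le_comap.mpr fun χ hχ => ?_
    have h_eigen : totalNumber n χ = (m : ℂ) • χ := Module.End.mem_eigenspace_iff.mp (ih hχ)
    rw [Submodule.mem_comap, Module.End.mem_eigenspace_iff,
      apply_apply_eq_add_of_lie_eq (lie_totalNumber_creat k), h_eigen, map_smul]
    push_cast
    module

theorem iSup_photonLevel_le_comap_position (j : Fin n) :
    ⨆ m, photonLevel n m ≤ (⨆ m, photonLevel n m).comap (position j) := by
  have h_creat : ∀ m, ∀ ψ ∈ photonLevel n m, creat j ψ ∈ ⨆ m, photonLevel n m := fun m ψ hψ =>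
    Submodule.mem_iSup_of_mem (m + 1) (creat_mem_photonLevel j hψ)
  have h_annih : ∀ m, photonLevel n m ≤ (⨆ m, photonLevel n m).comap (annih j)
    | 0 => photonLevel_zero_le_comap (by rw [annih_vacuum]; exact Submodule.zero_mem _)
    | m + 1 => fun ψ hψ => Submodule.mem_iSup_of_mem m (photonLevel_succ_le_comap_annih j m hψ)
  refine iSup_le fun m ψ hψ => ?_
  rw [Submodule.mem_comap, position_eq_smul_creat_add_annih]
  exact Submodule.smul_mem _ _ (Submodule.add_mem _ (h_creat m ψ hψ) (h_annih m hψ))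

theorem linearPosition_pow_vacuum_mem_iSup_photonLevel (ξ : Pos n) (k : ℕ) :
    (linearPosition ξ ^ k) (vacuum n) ∈ ⨆ m, photonLevel n m := by
  induction k with
  | zero => exact Submodule.mem_iSup_of_mem 0 (Submodule.mem_span_singleton_self _)
  | succ k ih =>
    rw [pow_succ', Module.End.mul_apply, linearPosition, LinearMap.sum_apply]
    exact Submodule.sum_mem _ fun j _ =>
      Submodule.smul_mem _ _ (iSup_photonLevel_le_comap_position j ih)

theorem orthogonal_iSup_map_photonLevel :
    (⨆ m, (photonLevel n m).map (toStateₗ n))ᗮ = ⊥ := by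
  rw [← Submodule.map_iSup, Submodule.eq_bot_iff]
  exact fun f hf => eq_zero_of_forall_inner_linearPosition_pow_vacuum_eq_zero fun ξ k =>
    hf _ (Submodule.mem_map_of_mem (linearPosition_pow_vacuum_mem_iSup_photonLevel ξ k))

theorem orthogonalFamily_map_photonLevel :
    OrthogonalFamily ℂ (fun m => (photonLevel n m).map (toStateₗ n))
      fun m => ((photonLevel n m).map (toStateₗ n)).subtypeₗᵢ := by
  have h_eigen : ∀ m, ∀ ψ ∈ photonLevel n m, totalNumber n ψ = (((m : ℝ) : ℂ)) • ψ :=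
    fun m ψ hψ => by
      simpa using Module.End.mem_eigenspace_iff.mp (photonLevel_le_eigenspace_totalNumber m hψ)
  rintro l m hlm ⟨_, ψ, hψ, rfl⟩ ⟨_, χ, hχ, rfl⟩
  exact isFormalAdjoint_totalNumber.inner_eq_zero_of_eigenvalue_ne (Nat.cast_injective.ne hlm)
    (h_eigen l ψ hψ) (h_eigen m χ hχ)

end PhotonLevel

section Compression

/-- The operator induced by `A` on the states given by the wavefunctions of an invariant
subspace. -/
def compression (A : Op n) {W : Submodule ℂ 𝓢(Pos n, ℂ)} (hW : ∀ ψ ∈ W, A ψ ∈ W) :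
    W.map (toStateₗ n) →ₗ[ℂ] W.map (toStateₗ n) :=
  (Submodule.equivMapOfInjective (toStateₗ n) toStateₗ_injective W).conj (A.restrict hW)

theorem compression_apply {A : Op n} {W : Submodule ℂ 𝓢(Pos n, ℂ)} (hW : ∀ ψ ∈ W, A ψ ∈ W)
    {ψ : 𝓢(Pos n, ℂ)} (hψ : ψ ∈ W) :
    (compression A hW ⟨toState ψ, Submodule.mem_map_of_mem hψ⟩ : Hilb n) = toState (A ψ) := by
  have h_symm : (Submodule.equivMapOfInjective (toStateₗ n) toStateₗ_injective W).symm
      ⟨toState ψ, Submodule.mem_map_of_mem hψ⟩ = ⟨ψ, hψ⟩ :=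
    (LinearEquiv.symm_apply_eq _).mpr rfl
  rw [compression, LinearEquiv.conj_apply_apply, h_symm]
  rfl

theorem isSymmetric_compression {A : Op n} (hA : IsFormalAdjoint A A)
    {W : Submodule ℂ 𝓢(Pos n, ℂ)} (hW : ∀ ψ ∈ W, A ψ ∈ W) : (compression A hW).IsSymmetric := by
  rintro ⟨_, ψ, hψ, rfl⟩ ⟨_, χ, hχ, rfl⟩
  calc inner ℂ (compression A hW ⟨toState ψ, _⟩ : Hilb n) (toState χ)
      = inner ℂ (toState (A ψ)) (toState χ) := by rw [compression_apply hW hψ]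
    _ = inner ℂ (toState ψ) (toState (A χ)) := hA ψ χ
    _ = inner ℂ (toState ψ) (compression A hW ⟨toState χ, _⟩ : Hilb n) := by
        rw [compression_apply hW hχ]

end Compression

section Eigenbasis

variable {ι : Type*} {A : Op n} {b : HilbertBasis ι ℂ (Hilb n)} {e : ι → 𝓢(Pos n, ℂ)}
  {lam : ι → ℝ}

/-- The Hilbert basis `b` is given by the Schwartz wavefunctions `e`, which are eigenfunctions of
`A` with eigenvalues `lam`. -/
structure IsEigenbasis (b : HilbertBasis ι ℂ (Hilb n)) (e : ι → 𝓢(Pos n, ℂ)) (A : Op n)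
    (lam : ι → ℝ) : Prop where
  toState_eq : ∀ k, toState (e k) = b k
  apply_eq : ∀ k, A (e k) = (lam k : ℂ) • e k

theorem exists_isEigenbasis_of_invariant {κ : Type*} {W : κ → Submodule ℂ 𝓢(Pos n, ℂ)}
    [∀ i, FiniteDimensional ℂ (W i)]
    (hW : OrthogonalFamily ℂ (fun i => (W i).map (toStateₗ n))
      fun i => ((W i).map (toStateₗ n)).subtypeₗᵢ)
    (hW_top : (⨆ i, (W i).map (toStateₗ n))ᗮ = ⊥) (hA : IsFormalAdjoint A A)
    (hAW : ∀ i, ∀ ψ ∈ W i, A ψ ∈ W i) :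
    ∃ (b : HilbertBasis (Σ i, Fin (Module.finrank ℂ ((W i).map (toStateₗ n)))) ℂ (Hilb n))
      (e : (Σ i, Fin (Module.finrank ℂ ((W i).map (toStateₗ n)))) → 𝓢(Pos n, ℂ))
      (lam : (Σ i, Fin (Module.finrank ℂ ((W i).map (toStateₗ n)))) → ℝ),
      IsEigenbasis b e A lam ∧ ∀ k, e k ∈ W k.1 := by
  obtain ⟨b, lam, h_eigen⟩ := exists_hilbertBasis_eigenvectors hW hW_top
    fun i => isSymmetric_compression hA (hAW i)
  have h_wave : ∀ k, ∃ ψ ∈ W k.1, toState ψ = b k ∧ A ψ = (lam k : ℂ) • ψ := fun k => by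
    obtain ⟨⟨_, ψ, hψ, rfl⟩, hb, h_apply⟩ := h_eigen k
    refine ⟨ψ, hψ, hb, toStateₗ_injective ?_⟩
    calc toState (A ψ) = compression A (hAW k.1) ⟨toState ψ, _⟩ :=
          (compression_apply (hAW k.1) hψ).symm
      _ = (lam k : ℂ) • toState ψ := congrArg Subtype.val h_apply
      _ = toState ((lam k : ℂ) • ψ) := (toState_smul _ _).symm
  choose e he_mem he_state he_apply using h_wave
  exact ⟨b, e, lam, ⟨he_state, he_apply⟩, he_mem⟩

theorem exists_isEigenbasis_quadHamiltonian_totalNumber {P : Matrix (Fin n) (Fin n) ℂ}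
    (hP : P.IsHermitian) :
    ∃ (ι : Type) (b : HilbertBasis ι ℂ (Hilb n)) (e : ι → 𝓢(Pos n, ℂ)) (lam μ : ι → ℝ),
      IsEigenbasis b e (quadHamiltonian P) lam ∧ IsEigenbasis b e (totalNumber n) μ := by
  obtain ⟨b, e, lam, h_eigen, h_mem⟩ := exists_isEigenbasis_of_invariant
    orthogonalFamily_map_photonLevel orthogonal_iSup_map_photonLevel
    (isFormalAdjoint_quadHamiltonian_of_isHermitian hP)
    fun m ψ hψ => quadHamiltonian_mem_photonLevel P hψ
  refine ⟨_, b, e, lam, fun k => k.1, h_eigen, h_eigen.toState_eq, fun k => ?_⟩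
  simpa using
    Module.End.mem_eigenspace_iff.mp (photonLevel_le_eigenspace_totalNumber k.1 (h_mem k))

namespace IsEigenbasis

theorem ofReal_smul (h : IsEigenbasis b e A lam) (θ : ℝ) :
    IsEigenbasis b e ((θ : ℂ) • A) fun k => θ * lam k where
  toState_eq := h.toState_eq
  apply_eq k := by rw [LinearMap.smul_apply, h.apply_eq, smul_smul, ofReal_mul]

theorem closedGraph_eq (h : IsEigenbasis b e A lam) (hA : IsFormalAdjoint A A) :
    closedGraph A = {p | ∀ k, b.repr p.2 k = lam k * b.repr p.1 k} := by
  let G := LinearMap.range ((toStateₗ n).prod ((toStateₗ n).comp A))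
  have h_symm : ∀ p ∈ G, ∀ q ∈ G, inner ℂ p.2 q.1 = inner ℂ p.1 q.2 := by
    rintro _ ⟨ψ, rfl⟩ _ ⟨χ, rfl⟩
    exact hA ψ χ
  have h_basis : ∀ k, (b k, (lam k : ℂ) • b k) ∈ G := fun k =>
    ⟨e k, Prod.ext (h.toState_eq k) (by
      rw [← h.toState_eq, ← toState_smul, ← h.apply_eq]
      rfl)⟩
  exact coe_topologicalClosure_eq_of_symmetric b lam h_symm h_basis

theorem isExpGroup_diagonalGroup (h : IsEigenbasis b e A lam) (hA : IsFormalAdjoint A A) :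
    IsExpGroup A (diagonalGroup b lam) where
  mem_unitary := diagonalGroup_mem_unitary b lam
  map_zero := diagonalGroup_zero b lam
  map_add := diagonalGroup_add b lam
  strongly_continuous := continuous_diagonalGroup_apply b lam
  generator := by
    rw [h.closedGraph_eq hA]
    exact Set.ext fun p => hasDerivAt_diagonalGroup_zero_iff b lam p.1 p.2

theorem map_diagonalGroup_mem_closedGraph (h : IsEigenbasis b e A lam)
    (hA : IsFormalAdjoint A A) (μ : ι → ℝ) (θ : ℝ) {f g : Hilb n} (hfg : (f, g) ∈ closedGraph A) :
    (diagonalGroup b μ θ f, diagonalGroup b μ θ g) ∈ closedGraph A := by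
  rw [h.closedGraph_eq hA] at hfg ⊢
  intro k
  rw [repr_diagonalGroup, repr_diagonalGroup, hfg k, mul_left_comm]

end IsEigenbasis

end Eigenbasis

section ExpGroup

variable {A : Op n} {U : ℝ → Hilb n →L[ℂ] Hilb n}

theorem IsExpGroup.apply_toState_of_eigenvector (hU : IsExpGroup A U) {ψ : 𝓢(Pos n, ℂ)} {c : ℂ}
    (hψ : A ψ = c • ψ) (θ : ℝ) : U θ (toState ψ) = cexp (θ * -(I * c)) • toState ψ := by
  have h_graph : (toState ψ, c • toState ψ) ∈ closedGraph A := by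
    rw [← toState_smul, ← hψ]
    exact subset_closure ⟨ψ, rfl⟩
  rw [← hU.generator] at h_graph
  have h_deriv : HasDerivAt (fun θ => U θ (toState ψ)) (-(I * c) • toState ψ) 0 := by
    rw [neg_smul, mul_smul]
    exact h_graph
  exact oneParameterGroup_apply_of_hasDerivAt_smul hU.map_zero hU.map_add h_deriv θ

theorem IsExpGroup.eq_of_isEigenbasis {U' : ℝ → Hilb n →L[ℂ] Hilb n} (hU : IsExpGroup A U)
    (hU' : IsExpGroup A U') {ι : Type*} {b : HilbertBasis ι ℂ (Hilb n)} {e : ι → 𝓢(Pos n, ℂ)}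
    {lam : ι → ℝ} (h : IsEigenbasis b e A lam) : U = U' := by
  ext1 θ
  refine ContinuousLinearMap.ext_on
    (Submodule.dense_iff_topologicalClosure_eq_top.mpr b.dense_span) ?_
  rintro _ ⟨k, rfl⟩
  rw [← h.toState_eq, hU.apply_toState_of_eigenvector (h.apply_eq k),
    hU'.apply_toState_of_eigenvector (h.apply_eq k)]

end ExpGroup

section PassiveHamiltonians

/-- `quadHamiltonian` as a linear map. -/
def quadHamiltonianₗ (n : ℕ) : Matrix (Fin n) (Fin n) ℂ →ₗ[ℂ] Op n where
  toFun := quadHamiltonian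
  map_add' P Q := by simp [quadHamiltonian, add_smul, Finset.sum_add_distrib]
  map_smul' c P := by simp [quadHamiltonian, Finset.smul_sum, smul_smul]

theorem quadHamiltonianₗ_apply (P : Matrix (Fin n) (Fin n) ℂ) :
    quadHamiltonianₗ n P = quadHamiltonian P := rfl

theorem quadHamiltonianₗ_single (r s : Fin n) (c : ℂ) :
    quadHamiltonianₗ n (Matrix.single r s c) = c • (creat r * annih s) := by
  simp [quadHamiltonianₗ_apply, quadHamiltonian, Matrix.single_apply, ite_and, ite_smul]

/-- The compact quadratic Hamiltonians, as a real vector space of operators. -/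
def passiveHamiltonians (n : ℕ) : Submodule ℝ (Op n) :=
  (selfAdjoint.submodule ℝ (Matrix (Fin n) (Fin n) ℂ)).map ((quadHamiltonianₗ n).restrictScalars ℝ)

theorem mem_passiveHamiltonians {A : Op n} :
    A ∈ passiveHamiltonians n ↔ ∃ P, P.IsHermitian ∧ quadHamiltonian P = A := Iff.rfl

theorem smul_add_conj_smul_mem_passiveHamiltonians (r s : Fin n) (c : ℂ) :
    c • (creat r * annih s) + starRingEnd ℂ c • (creat s * annih r) ∈ passiveHamiltonians n := by
  refine mem_passiveHamiltonians.mpr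
    ⟨Matrix.single r s c + Matrix.single s r (starRingEnd ℂ c), ?_, ?_⟩
  · simp [Matrix.IsHermitian, Matrix.conjTranspose_single, add_comm]
  · rw [← quadHamiltonianₗ_apply, map_add, quadHamiltonianₗ_single, quadHamiltonianₗ_single]

theorem ofReal_smul_creat_mul_annih_mem_passiveHamiltonians (r : Fin n) (c : ℝ) :
    (c : ℂ) • (creat r * annih r) ∈ passiveHamiltonians n := by
  refine mem_passiveHamiltonians.mpr ⟨Matrix.single r r (c : ℂ), ?_, quadHamiltonianₗ_single r r _⟩
  simp [Matrix.IsHermitian, Matrix.conjTranspose_single]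

theorem schwinger_mem_passiveHamiltonians (r s : Fin n) (a : Axis) :
    schwinger r s a ∈ passiveHamiltonians n := by
  have h_diag := fun (j : Fin n) (c : ℝ) => ofReal_smul_creat_mul_annih_mem_passiveHamiltonians j c
  have h_offDiag := smul_add_conj_smul_mem_passiveHamiltonians r s
  cases a with
  | zero =>
    convert! add_mem (h_diag r (1 / 2)) (h_diag s (1 / 2)) using 1
    simp [schwinger]
  | x =>
    convert! h_offDiag (1 / 2) using 1
    simp [schwinger, conj_ofNat]
  | y =>
    convert! h_offDiag (1 / (2 * I)) using 1
    simp [schwinger, sub_eq_add_neg, conj_ofNat]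
  | z =>
    convert! sub_mem (h_diag r (1 / 2)) (h_diag s (1 / 2)) using 1
    simp [schwinger, smul_sub]

theorem IsSchwingerCombination.mem_passiveHamiltonians {N : Op n}
    (hN : IsSchwingerCombination N) : N ∈ passiveHamiltonians n := by
  obtain ⟨c, rfl⟩ := hN
  have h_smul : ∀ r s a, (c r s a : ℂ) • schwinger r s a ∈ passiveHamiltonians n := fun r s a => by
    rw [Complex.coe_smul]
    exact Submodule.smul_mem _ _ (schwinger_mem_passiveHamiltonians r s a)
  exact Submodule.sum_mem _ fun r _ => Submodule.sum_mem _ fun s _ =>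
    add_mem (add_mem (add_mem (h_smul r s _) (h_smul r s _)) (h_smul r s _)) (h_smul r s _)

theorem IsEigenbasis.isPassiveInterferometric_diagonalGroup {P : Matrix (Fin n) (Fin n) ℂ}
    (hP : P.IsHermitian) {ι : Type*} {b : HilbertBasis ι ℂ (Hilb n)} {e : ι → 𝓢(Pos n, ℂ)}
    {lam : ι → ℝ} (h : IsEigenbasis b e (quadHamiltonian P) lam) (θ : ℝ) :
    IsPassiveInterferometric (diagonalGroup b lam θ) := by
  have hθP : (θ • P).IsHermitian := IsSelfAdjoint.smul (.all θ) hP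
  have h_scaled : IsEigenbasis b e (quadHamiltonian (θ • P)) fun k => θ * lam k := by
    convert! h.ofReal_smul θ using 1
    exact map_smul (quadHamiltonianₗ n) (θ : ℂ) P
  refine ⟨θ • P, hθP, diagonalGroup b fun k => θ * lam k,
    h_scaled.isExpGroup_diagonalGroup (isFormalAdjoint_quadHamiltonian_of_isHermitian hθP), ?_⟩
  rw [diagonalGroup_mul_left, one_mul]

end PassiveHamiltonians

end Qumode

theorem theorem1_general (n : ℕ) (φ : Qumode.Hilb n) (N : Qumode.Op n)
    (hN : Qumode.IsSchwingerNullifier N φ) :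
    ∃ U : ℝ → Qumode.Hilb n →L[ℂ] Qumode.Hilb n,
      Qumode.IsExpGroup N U ∧
      (∀ U' : ℝ → Qumode.Hilb n →L[ℂ] Qumode.Hilb n, Qumode.IsExpGroup N U' → U' = U) ∧
      ∀ θ : ℝ, Qumode.IsPassiveInterferometric (U θ) ∧
        Qumode.ConservesPhotonNumber (U θ) ∧
        U θ φ = φ := by
  obtain ⟨h_schwinger, ψ, rfl, hψ⟩ := hN
  obtain ⟨P, hP, rfl⟩ := Qumode.mem_passiveHamiltonians.mp h_schwinger.mem_passiveHamiltonians
  obtain ⟨ι, b, e, lam, μ, hlam, hμ⟩ :=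
    Qumode.exists_isEigenbasis_quadHamiltonian_totalNumber hP
  have hU := hlam.isExpGroup_diagonalGroup
    (Qumode.isFormalAdjoint_quadHamiltonian_of_isHermitian hP)
  refine ⟨diagonalGroup b lam, hU, fun U' hU' => hU'.eq_of_isEigenbasis hU hlam, fun θ =>
    ⟨hlam.isPassiveInterferometric_diagonalGroup hP θ, fun f g hfg => ?_, ?_⟩⟩
  · exact hμ.map_diagonalGroup_mem_closedGraph Qumode.isFormalAdjoint_totalNumber lam θ hfg
  · simpa using hU.apply_toState_of_eigenvector (c := 0) (by simpa using hψ) θ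

end

theorem theorem1 (n : ℕ) (K : Matrix (Fin n) (Fin n) ℂ) (φ : Qumode.Hilb n)
    (hφ : Qumode.IsGaussianPureState K φ) (N : Qumode.Op n)
    (hN : Qumode.IsSchwingerNullifier N φ) :
    ∃ U : ℝ → Qumode.Hilb n →L[ℂ] Qumode.Hilb n,
      Qumode.IsExpGroup N U ∧
      (∀ U' : ℝ → Qumode.Hilb n →L[ℂ] Qumode.Hilb n, Qumode.IsExpGroup N U' → U' = U) ∧
      ∀ θ : ℝ, Qumode.IsPassiveInterferometric (U θ) ∧
        Qumode.ConservesPhotonNumber (U θ) ∧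
        U θ φ = φ :=
  theorem1_general n φ N hN
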